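/- Let $p$ be a prime, $k$ a field of characteristic $p$, $G$ a finite group and $P$ a Sylow $p$-subgroup of $G$. For a $kP$-module $M$ write $M{\uparrow}^G = kG\otimes_{kP}M$ for the induced $kG$-module, and for a $kG$-module $N$ write $N{\downarrow}_P$ for its restriction to $kP$. Let $\operatorname{add} M$ denote the class of all $kP$-modules that are isomorphic to a direct summand of a finite direct sum $M^n$ ($n\ge 0$) of copies of $M$. For a ring $R$, let $\operatorname{gldim} R$ be the supremum (possibly $\infty$) of the projective dimensions of all right $R$-modules, where the zero module has projective dimension $-\infty$. If $M$ is a $kP$-module such that $(M{\uparrow}^G){\downarrow}_P \in \operatorname{add} M$, then $$\operatorname{gldim}\operatorname{End}_{kG}(M{\uparrow}^G)\;\le\;\operatorname{gldim}\operatorname{End}_{kP}(M).$$ -/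

import Mathlib

open CategoryTheory CategoryTheory.Limits

universe u v w t

/-- The global dimension of a ring `R`: the supremum of the projective dimensions of all right
`R`-modules (that is, modules over the opposite ring), as an element of `{-∞} ∪ ℕ ∪ {∞}`.
The zero module has projective dimension `-∞`. -/
noncomputable def globalDimension (R : Type t) [Ring R] : WithBot ℕ∞ :=
  ⨆ N : ModuleCat.{t} Rᵐᵒᵖ, projectiveDimension N

/-- `InAdd M X` says that `X` lies in the additive closure `add M` of `M`: it is a direct summand
of a finite direct sum of copies of `M`. -/
def InAdd {C : Type u} [Category.{v} C] [Preadditive C] [HasFiniteBiproducts C]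
    (M X : C) : Prop :=
  ∃ n : ℕ, Nonempty (Retract X (⨁ fun _ : Fin n => M))

/-- The category of `k`-linear representations of `G` (that is, of `kG`-modules) has finite
direct sums. -/
instance Rep.hasFiniteBiproductsOfField {k : Type u} {G : Type v} [Field k] [Group G] :
    HasFiniteBiproducts (Rep.{w} k G) :=
  HasFiniteBiproducts.of_hasFiniteProducts

section RingExtension

/-! Induction gives a ring map `End M → End (M↑G)`. As `M↑G↓P` lies in `add M`, adjunction makes the
target finitely generated projective over the source as a right module. As the index of `P` is
invertible in `k`, the counit of induction and restriction splits naturally, which makes the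
extension separable. Restriction of scalars then preserves and reflects projectivity, so by
dimension shifting it cannot lower projective dimension. -/

lemma CategoryTheory.ShortComplex.ShortExact.map_restrictScalars {A B : Type*} [Ring A] [Ring B]
    {S : ShortComplex (ModuleCat.{t} B)} (hS : S.ShortExact) (ψ : A →+* B) :
    (S.map (ModuleCat.restrictScalars ψ)).ShortExact where
  exact := (ShortComplex.ShortExact.moduleCat_exact_iff_function_exact _).2
    ((ShortComplex.ShortExact.moduleCat_exact_iff_function_exact S).1 hS.exact)
  mono_f := (ModuleCat.mono_iff_injective _).2 hS.moduleCat_injective_f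
  epi_g := (ModuleCat.epi_iff_surjective _).2 hS.moduleCat_surjective_g

variable {A B : Type t} [Ring A] [Ring B] {ψ : A →+* B}

/-- A dual basis for `B` as a left module along `ψ : A →+* B`, together with a compatible family
`b` which makes the extension separable: the element `∑ i, b i ⊗ a i` of `B ⊗_A B` is central and
is mapped to `1` by the multiplication. -/
structure SeparatingDualBasis (ψ : A →+* B) (ι : Type*) [Fintype ι] where
  a : ι → B
  b : ι → B
  coord : ι → B →+ A
  coord_map_mul : ∀ i x y, coord i (ψ x * y) = x * coord i y
  sum_map_coord_mul : ∀ y, ∑ i, ψ (coord i y) * a i = y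
  sum_b_mul_a : ∑ i, b i * a i = 1
  mul_b : ∀ y j, y * b j = ∑ i, b i * ψ (coord j (a i * y))

namespace SeparatingDualBasis

variable {ι : Type*} [Fintype ι] (D : SeparatingDualBasis ψ ι)
include D

/-- Restriction along `ψ` preserves projective modules. -/
lemma projective_restrictScalars {X : Type*} [AddCommGroup X] [Module A X] [Module B X]
    (hψ : ∀ (c : A) (x : X), c • x = ψ c • x) [Module.Projective B X] :
    Module.Projective A X := by
  obtain ⟨s, hs⟩ := (Module.projective_def (R := B) (P := X)).1 inferInstance
  -- The dual basis exhibits `B` as an `A`-summand of `ι → A`; combined with the splitting `s`, it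
  -- makes `X` a retract of a free `A`-module when `ι` is finite.
  let r : X →ₗ[A] (ι → X →₀ A) :=
    { toFun x i := (s x).mapRange (D.coord i) (map_zero _)
      map_add' x y := by ext; simp
      map_smul' c x := by ext; simp [hψ, D.coord_map_mul] }
  let q : (ι → X →₀ A) →ₗ[A] X :=
    ∑ i, Finsupp.linearCombination A (fun x : X => D.a i • x) ∘ₗ LinearMap.proj i
  refine Module.Projective.of_split r q (LinearMap.ext fun x => Eq.trans ?_ (hs x))
  have h (i : ι) : Finsupp.linearCombination A (fun x : X => D.a i • x) (r x i) =
      ∑ y ∈ (s x).support, (ψ (D.coord i (s x y)) * D.a i) • y := by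
    rw [Finsupp.linearCombination_apply]
    refine (Finsupp.sum_mapRange_index (hf := map_zero (D.coord i))
      (h := fun (y : X) (c : A) => c • D.a i • y) fun y => zero_smul A _).trans ?_
    exact Finset.sum_congr rfl fun y _ => (hψ _ _).trans (mul_smul _ _ y).symm
  simp only [q, LinearMap.comp_apply, LinearMap.sum_apply, LinearMap.proj_apply, h,
    Finsupp.linearCombination_apply, Finsupp.sum]
  rw [Finset.sum_comm]
  simp only [← Finset.sum_smul, D.sum_map_coord_mul, id_eq]

/-- A module which is projective after restriction along `ψ` is projective: sections over `A` are
averaged to sections over `B`. -/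
lemma projective_of_restrictScalars {X : Type*} [AddCommGroup X] [Module A X] [Module B X]
    (hψ : ∀ (c : A) (x : X), c • x = ψ c • x) [Module.Projective A X] :
    Module.Projective B X := by
  let _ : Module A (X →₀ B) := Module.compHom _ ψ
  let π : (X →₀ B) →ₗ[A] X :=
    { Finsupp.linearCombination B (id : X → X) with
      map_smul' c z := (map_smul (Finsupp.linearCombination B (id : X → X)) (ψ c) z).trans
        (hψ c _).symm }
  obtain ⟨s, hs⟩ := Module.projective_lifting_property π LinearMap.id
    (Finsupp.linearCombination_id_surjective B X)
  have hs' (x : X) : Finsupp.linearCombination B (id : X → X) (s x) = x := LinearMap.congr_fun hs x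
  have hs₀ (c : A) (x : X) : s (ψ c • x) = ψ c • s x := by
    rw [← hψ]
    exact s.map_smul c x
  refine Module.projective_def.2 ⟨
    { toFun x := ∑ i, D.b i • s (D.a i • x)
      map_add' x y := by simp [smul_add, Finset.sum_add_distrib]
      map_smul' y x := ?_ }, fun x => ?_⟩
  -- Expanding `a i * y` in the dual basis lets the `A`-linearity of `s` pull out the coefficients;
  -- `mul_b` then moves `y` to the front.
  · have h (i : ι) : s (D.a i • y • x) = ∑ j, ψ (D.coord j (D.a i * y)) • s (D.a j • x) := by
      rw [← mul_smul, ← D.sum_map_coord_mul (D.a i * y), Finset.sum_smul, map_sum]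
      simp only [mul_smul, hs₀, D.sum_map_coord_mul]
    simp only [h, RingHom.id_apply, Finset.smul_sum]
    rw [Finset.sum_comm]
    simp only [← mul_smul, ← Finset.sum_smul, D.mul_b]
  · simp only [LinearMap.coe_mk, AddHom.coe_mk, map_sum, map_smul, hs', ← mul_smul,
      ← Finset.sum_smul, D.sum_b_mul_a, one_smul]

/-- A projective cover sequence over `B` stays one over `A`, so syzygies can be compared. The shift
only goes from `n + 2` to `n + 1`, hence two base cases: zero and projective modules. -/
lemma hasProjectiveDimensionLT (n : ℕ) (X : ModuleCat.{t} B)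
    (hX : HasProjectiveDimensionLT ((ModuleCat.restrictScalars ψ).obj X) n) :
    HasProjectiveDimensionLT X n := by
  induction n using Nat.strong_induction_on generalizing X with | _ n ih =>
  match n with
  | 0 =>
    rw [hasProjectiveDimensionLT_zero_iff_isZero] at hX ⊢
    have : Subsingleton X :=
      ModuleCat.subsingleton_of_isZero (M := (ModuleCat.restrictScalars ψ).obj X) hX
    exact ModuleCat.isZero_of_subsingleton X
  | 1 =>
    rw [← projective_iff_hasProjectiveDimensionLT_one, ← IsProjective.iff_projective] at hX ⊢
    let _ : Module A X := Module.compHom _ ψ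
    have : Module.Projective A X := hX
    exact D.projective_of_restrictScalars fun _ _ => rfl
  | n + 2 =>
    have hS := X.shortExact_projectiveShortComplex
    have hS' := hS.map_restrictScalars ψ
    have hp : Projective ((ModuleCat.restrictScalars ψ).obj X.projectiveShortComplex.X₂) := by
      rw [← IsProjective.iff_projective]
      let _ : Module A X.projectiveShortComplex.X₂ := Module.compHom _ ψ
      exact D.projective_restrictScalars (X := X.projectiveShortComplex.X₂) fun _ _ => rfl
    rw [hS.hasProjectiveDimensionLT_X₃_iff n inferInstance]
    exact ih (n + 1) (by lia) _ ((hS'.hasProjectiveDimensionLT_X₃_iff n hp).1 hX)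

lemma projectiveDimension_le (X : ModuleCat.{t} B) :
    projectiveDimension X ≤ projectiveDimension ((ModuleCat.restrictScalars ψ).obj X) :=
  sInf_le_sInf fun _ h i hi => D.hasProjectiveDimensionLT i X (h i hi)

end SeparatingDualBasis
end RingExtension

lemma SeparatingDualBasis.globalDimension_le {A B : Type t} [Ring A] [Ring B] {ψ : A →+* B}
    {ι : Type*} [Fintype ι] (D : SeparatingDualBasis ψ.op ι) :
    globalDimension B ≤ globalDimension A :=
  iSup_le fun X => (D.projectiveDimension_le X).trans
    (le_iSup (f := fun N => projectiveDimension N) _)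

section Adjunction

variable {C : Type*} {D : Type*} [Category.{t} C] [Category.{t} D] [Preadditive C] [Preadditive D]

/-- An additive functor induces ring homomorphisms between endomorphism rings. -/
def CategoryTheory.Functor.mapEndRingHom (L : C ⥤ D) [L.Additive] (M : C) :
    End M →+* End (L.obj M) where
  __ := L.mapEnd M
  map_zero' := L.map_zero M M
  map_add' _ _ := L.map_add

/-- If `X` is in the additive closure of `M`, then its identity is a sum of endomorphisms which
factor through `M`. -/
lemma InAdd.exists_sum_comp_eq_id [HasFiniteBiproducts C] {M X : C} (h : InAdd M X) :
    ∃ (n : ℕ) (g : Fin n → (X ⟶ M)) (f : Fin n → (M ⟶ X)), ∑ i, g i ≫ f i = 𝟙 X := by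
  obtain ⟨n, ⟨r⟩⟩ := h
  refine ⟨n, fun i => r.i ≫ biproduct.π (fun _ : Fin n => M) i,
    fun i => biproduct.ι (fun _ : Fin n => M) i ≫ r.r, ?_⟩
  have := congrArg (fun e => r.i ≫ e ≫ r.r) (biproduct.total (f := fun _ : Fin n => M))
  simpa [-biproduct.total, Preadditive.comp_sum, Preadditive.sum_comp] using this

variable {L : C ⥤ D} {R : D ⥤ C} [L.Additive] [R.Additive]

/-- Let `L` be left adjoint to `R`, with a natural section `τ` of the counit. If the identity of
`R (L M)` is a sum of endomorphisms which factor through `M`, then `End M → End (L M)` has a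
separating dual basis. -/
noncomputable def CategoryTheory.Adjunction.separatingDualBasis (adj : L ⊣ R) (τ : 𝟭 D ⟶ R ⋙ L)
    (hτ : τ ≫ adj.counit = 𝟙 _) {M : C} {n : ℕ} (g : Fin n → (R.obj (L.obj M) ⟶ M))
    (f : Fin n → (M ⟶ R.obj (L.obj M))) (hgf : ∑ i, g i ≫ f i = 𝟙 _) :
    SeparatingDualBasis (L.mapEndRingHom M).op (Fin n) where
  -- `a i` is the adjoint transpose of `f i`, and `coord i` transposes back and composes with `g i`.
  -- The section `τ` enters only through `b i`; its naturality gives `mul_b`.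
  a i := .op (L.map (f i) ≫ adj.counit.app (L.obj M))
  b i := .op (τ.app (L.obj M) ≫ L.map (g i))
  coord i :=
    { toFun h := .op (adj.unit.app M ≫ R.map (MulOpposite.unop h) ≫ g i)
      map_zero' := by
        change MulOpposite.op (adj.unit.app M ≫ R.map 0 ≫ g i) = _
        simp
      map_add' x y := by
        change MulOpposite.op
          (adj.unit.app M ≫ R.map (MulOpposite.unop x + MulOpposite.unop y) ≫ g i) = _
        simp [R.map_add] }
  coord_map_mul i x y := by
    obtain ⟨x⟩ := x
    obtain ⟨y⟩ := y
    refine congrArg MulOpposite.op ?_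
    change adj.unit.app M ≫ R.map (L.map x ≫ y) ≫ g i = x ≫ adj.unit.app M ≫ R.map y ≫ g i
    simp
  sum_map_coord_mul y := by
    obtain ⟨y⟩ := y
    apply MulOpposite.unop_injective
    rw [Finset.unop_sum]
    change ∑ i, L.map (adj.unit.app M ≫ R.map y ≫ g i) ≫ L.map (f i) ≫ adj.counit.app _ = y
    have h (i : Fin n) : L.map (adj.unit.app M ≫ R.map y ≫ g i) ≫ L.map (f i) ≫ adj.counit.app _ =
        L.map (adj.unit.app M ≫ R.map y) ≫ L.map (g i ≫ f i) ≫ adj.counit.app _ := by simp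
    rw [Finset.sum_congr rfl fun i _ => h i, ← Preadditive.comp_sum, ← Preadditive.sum_comp,
      ← L.map_sum, hgf]
    simp
  sum_b_mul_a := by
    apply MulOpposite.unop_injective
    rw [Finset.unop_sum]
    change ∑ i, (τ.app (L.obj M) ≫ L.map (g i)) ≫ L.map (f i) ≫ adj.counit.app _ = 𝟙 (L.obj M)
    have h (i : Fin n) : (τ.app (L.obj M) ≫ L.map (g i)) ≫ L.map (f i) ≫ adj.counit.app _ =
        τ.app (L.obj M) ≫ L.map (g i ≫ f i) ≫ adj.counit.app _ := by simp
    rw [Finset.sum_congr rfl fun i _ => h i, ← Preadditive.comp_sum, ← Preadditive.sum_comp,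
      ← L.map_sum, hgf]
    simpa using NatTrans.congr_app hτ (L.obj M)
  mul_b y j := by
    obtain ⟨y⟩ := y
    apply MulOpposite.unop_injective
    rw [Finset.unop_sum]
    change y ≫ τ.app (L.obj M) ≫ L.map (g j) = ∑ i, (τ.app (L.obj M) ≫ L.map (g i)) ≫
      L.map (adj.unit.app M ≫ R.map ((L.map (f i) ≫ adj.counit.app _) ≫ y) ≫ g j)
    have h (i : Fin n) : (τ.app (L.obj M) ≫ L.map (g i)) ≫
        L.map (adj.unit.app M ≫ R.map ((L.map (f i) ≫ adj.counit.app _) ≫ y) ≫ g j) =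
        τ.app (L.obj M) ≫ L.map (g i ≫ f i) ≫ L.map (R.map y ≫ g j) := by simp
    rw [Finset.sum_congr rfl fun i _ => h i, ← Preadditive.comp_sum, ← Preadditive.sum_comp,
      ← L.map_sum, hgf]
    simpa using τ.naturality_assoc y (L.map (g j))

end Adjunction

section Rep

/-- The composition of the unit of restriction and induction with the counit of induction and
restriction is multiplication by the index. -/
lemma Rep.resIndAdjunction_unit_comp_indResAdjunction_counit {k : Type u} [CommRing k] {G : Type v}
    [Group G] (S : Subgroup G) [S.FiniteIndex] [DecidableRel (QuotientGroup.rightRel S)]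
    (N : Rep.{max u v w} k G) :
    (Rep.resIndAdjunction.{w} k S).unit.app N ≫
      (Rep.indResAdjunction.{max u v w} k S.subtype).counit.app N = (S.index : k) • 𝟙 N := by
  ext x
  have hmk (g : G) (y : N) : ((Rep.indResAdjunction.{max u v w} k S.subtype).counit.app N).hom
      (Representation.IndV.mk S.subtype (Rep.res S.subtype N).ρ g y) = N.ρ g⁻¹ y := by
    change ((Rep.indResHomEquiv S.subtype _ N).symm (𝟙 (Rep.res S.subtype N))).hom _ = _
    simp [Rep.indResHomEquiv]
  let φ := Rep.resCoindToHom.{u, v, v, max u w} S.subtype N _ (𝟙 (Rep.res S.subtype N))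
  change ((Rep.indResAdjunction.{max u v w} k S.subtype).counit.app N).hom
    (Rep.coindToInd (Rep.res S.subtype N) (φ.hom x)) = (S.index : k) • x
  rw [Rep.coindToInd_apply, map_sum, Finset.sum_congr rfl (g := fun _ => x)]
  · rw [Finset.sum_const, Nat.cast_smul_eq_nsmul]
    congr 1
    let _ := S.fintypeQuotientOfFiniteIndex
    rw [Finset.card_univ, ← Nat.card_eq_fintype_card, Subgroup.index]
    exact Nat.card_congr (QuotientGroup.quotientRightRelEquivQuotientLeftRel S)
  -- Each coset contributes `x`, since the actions of `g` and `g⁻¹` cancel.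
  · intro q _
    induction q using Quotient.inductionOn with | h g =>
    refine (hmk _ _).trans ?_
    change N.ρ g⁻¹ (N.ρ g x) = x
    simp

theorem mainTheorem5 {k : Type u} [Field k] {G : Type v} [Group G] [Finite G]
    (p : ℕ) [Fact p.Prime] [CharP k p] (P : Sylow p G)
    (M : Rep.{max u v w} k (P : Subgroup G))
    (hM : InAdd M (Rep.res (P : Subgroup G).subtype (Rep.ind (P : Subgroup G).subtype M))) :
    globalDimension (End (Rep.ind (P : Subgroup G).subtype M)) ≤ globalDimension (End M) := by
  classical
  have := (Rep.indResAdjunction.{max u v w} k (P : Subgroup G).subtype).left_adjoint_additive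
  obtain ⟨n, g, f, h⟩ := hM.exists_sum_comp_eq_id
  have hp : ((P : Subgroup G).index : k) ≠ 0 := by
    rw [Ne, CharP.cast_eq_zero_iff k p]
    exact P.not_dvd_index
  -- The unit of the other adjunction, divided by the index, is the natural section of the counit.
  have hτ : (((P : Subgroup G).index : k)⁻¹ •
      (Rep.resIndAdjunction.{w} k (P : Subgroup G)).unit) ≫
        (Rep.indResAdjunction.{max u v w} k (P : Subgroup G).subtype).counit = 𝟙 _ := by
    ext1
    ext1 N
    rw [NatTrans.comp_app, NatTrans.app_smul, Linear.smul_comp]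
    refine (congrArg _
      (Rep.resIndAdjunction_unit_comp_indResAdjunction_counit (P : Subgroup G) N)).trans ?_
    rw [smul_smul, inv_mul_cancel₀ hp, one_smul]
    rfl
  exact (Adjunction.separatingDualBasis _ _ hτ g f h).globalDimension_le

end Rep
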